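/- Let $(W,S)$ be a Coxeter system with $W$ finite and length function $l$. Let $\Gamma$ be an abelian group (written additively) with a total order compatible with addition, and let $L\colon W\to\Gamma$ be a weight function, i.e. $L(ww')=L(w)+L(w')$ whenever $l(ww')=l(w)+l(w')$, such that $L(s)>0$ for all $s\in S$. Let $R\subseteq\mathbb C$ be a subring containing $2\cos(2\pi/m_{st})$ for all $s,t\in S$, where $m_{st}$ is the order of $st$. Let $F$ be the field of fractions of $R$, let $A=R[\Gamma]$ be the group ring with $R$-basis $\{\varepsilon^g\mid g\in\Gamma\}$, and let $K$ be the field of fractions of $A$. Let $\mathbf H$ be the generic Iwahori–Hecke algebra over $A$, with basis $\{T_w\mid w\in W\}$, identity element $T_1$, and multiplication $$T_sT_w=\begin{cases}T_{sw}&\text{if } l(sw)>l(w),\\ T_{sw}+(\varepsilon^{L(s)}-\varepsilon^{-L(s)})T_w&\text{if } l(sw)<l(w),\end{cases}\qquad s\in S,\ w\in W,$$ and put $\mathbf H_K=K\otimes_A\mathbf H$. Every $0\neq x\in K$ can be written as $x=r_x\varepsilon^{g_x}(1+p)/(1+q)$ with $p,q$ in $F[\Gamma_{>0}]$ (the $F$-span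 of all $\varepsilon^g$ with $g>0$), where $0\neq r_x\in F$ and $g_x\in\Gamma$ are uniquely determined. Let $\mathcal O=\{0\}\cup\{x\neq0\mid g_x\ge 0\}$ and $\mathfrak p=\{0\}\cup\{x\neq 0\mid g_x>0\}$; the constant term of $x\in\mathcal O$ is the unique $r\in F$ with $x-r\in\mathfrak p$. Let $\{E^\lambda_\varepsilon\mid\lambda\in\Lambda\}$ be a complete set of representatives of the isomorphism classes of irreducible representations of $\mathbf H_K$, and let $d_\lambda=\dim E^\lambda_\varepsilon$. Define $\boldsymbol c_\lambda$ by $$\sum_{w\in W}\operatorname{trace}(T_w,E^\lambda_\varepsilon)\operatorname{trace}(T_{w^{-1}},E^\lambda_\varepsilon)=d_\lambda\boldsymbol c_\lambda,$$ and define $\boldsymbol a_\lambda\in\Gamma$ and $0\ne f_\lambda\in F$ by the condition that $\boldsymbol c_\lambda=f_\lambda\varepsilon^{-2\boldsymbol a_\lambda}+{}$a combination of terms $\varepsilon^g$ with $g>-2\boldsymbol a_\lambda$. For each $\lambda\in\Lambda$ let $\rho^\lambda\colon\mathbf H_K\to M_{d_\lambda}(K)$ be a matrix representation afforded by $E^\lambda_\varepsilon$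 which is balanced, i.e. $\varepsilon^{\boldsymbol a_\lambda}\rho^\lambda_{ij}(T_w)\in\mathcal O$ for all $w,i,j$, and let the leading matrix coefficient $c^{ij}_{w,\lambda}\in F$ be the constant term of $(-1)^{l(w)}\varepsilon^{\boldsymbol a_\lambda}\rho^\lambda_{ij}(T_w)$. For $x,y,z\in W$ set $$\tilde\gamma_{x,y,z}=\sum_{\lambda\in\Lambda}\ \sum_{1\le i,j,k\le d_\lambda}f_\lambda^{-1}\,c^{ij}_{x,\lambda}\,c^{jk}_{y,\lambda}\,c^{ki}_{z,\lambda},$$ and let $\tilde{\mathbf J}$ be the $F$-vector space with basis $\{t_w\mid w\in W\}$ and bilinear product $t_xt_y=\sum_{z\in W}\tilde\gamma_{x,y,z^{-1}}\,t_z$. **Proposition 3.8.** The linear map $\tilde{\mathbf J}\to\tilde{\mathbf J}$ with $t_w\mapsto t_{w^{-1}}$ is an anti-involution: applied twice it is the identity, and it reverses products. That is, $\tilde\gamma_{x,y,z}=\tilde\gamma_{y^{-1},x^{-1},z^{-1}}$ for all $x,y,z\in W$. -/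

import Mathlib

namespace GeckHecke

noncomputable section

/-! ### Coefficient rings -/

/-- The ring `ℤ_W = ℤ[2 cos (2π / m_st) | s, t ∈ S]`, where `m_st` is the order of `s t` in `W`. -/
def cosRing {B W : Type*} [Group W] {M : CoxeterMatrix B} (cs : CoxeterSystem M W) : Subring ℂ :=
  Subring.closure {x : ℂ | ∃ i j : B,
    x = ((2 * Real.cos (2 * Real.pi / (orderOf (cs.simple i * cs.simple j) : ℝ)) : ℝ) : ℂ)}

/-- A weight function `L : W → Γ`. -/
def IsWeightFunction {B W Γ : Type*} [Group W] [AddCommGroup Γ] {M : CoxeterMatrix B}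
    (cs : CoxeterSystem M W) (L : W → Γ) : Prop :=
  ∀ w w' : W, cs.length (w * w') = cs.length w + cs.length w' → L (w * w') = L w + L w'

/-- The group ring `A = R[Γ]`. (The ring `R` will be a subring of `ℂ`.) -/
abbrev Coeff (R : Type*) [CommRing R] (Γ : Type*) [AddCommGroup Γ] : Type _ := AddMonoidAlgebra R Γ

/-- The field of fractions `F` of `R`. -/
abbrev BaseField (R : Type*) [CommRing R] : Type _ := FractionRing R

/-- The field of fractions `K` of `A = R[Γ]`. -/
abbrev GenField (R : Type*) [CommRing R] (Γ : Type*) [AddCommGroup Γ] : Type _ :=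
  FractionRing (Coeff R Γ)

/-! ### The generic Iwahori--Hecke algebra -/

section Hecke

variable {B W Γ : Type*} [Group W] [AddCommGroup Γ] {M : CoxeterMatrix B}

/-- The defining relations: `T_1` is the identity element, and the multiplication rule for
`T_s T_w`, where `v_s = ε ^ L(s)`. -/
inductive HeckeRel (cs : CoxeterSystem M W) (R : Type*) [CommRing R] (L : W → Γ) :
    FreeAlgebra (Coeff R Γ) W → FreeAlgebra (Coeff R Γ) W → Prop
  | one : HeckeRel cs R L (FreeAlgebra.ι _ 1) 1
  | up (i : B) (w : W) (h : cs.length w < cs.length (cs.simple i * w)) :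
      HeckeRel cs R L (FreeAlgebra.ι _ (cs.simple i) * FreeAlgebra.ι _ w)
        (FreeAlgebra.ι _ (cs.simple i * w))
  | down (i : B) (w : W) (h : cs.length (cs.simple i * w) < cs.length w) :
      HeckeRel cs R L (FreeAlgebra.ι _ (cs.simple i) * FreeAlgebra.ι _ w)
        (FreeAlgebra.ι _ (cs.simple i * w) +
          ((AddMonoidAlgebra.single (L (cs.simple i)) 1 -
            AddMonoidAlgebra.single (-L (cs.simple i)) 1 : Coeff R Γ)) • FreeAlgebra.ι _ w)

/-- The generic Iwahori--Hecke algebra `H = H_A(W, S, L)` over `A = R[Γ]`: the associative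
`A`-algebra generated by the `T_w` (`w ∈ W`), which multiply according to the rule for `T_s T_w`.
(For a weight function `L` the `T_w` form an `A`-basis of this algebra.) -/
def Hecke (cs : CoxeterSystem M W) (R : Type*) [CommRing R] (L : W → Γ) : Type _ :=
  RingQuot (HeckeRel cs R L)

instance (cs : CoxeterSystem M W) (R : Type*) [CommRing R] (L : W → Γ) : Ring (Hecke cs R L) :=
  inferInstanceAs (Ring (RingQuot (HeckeRel cs R L)))

instance (cs : CoxeterSystem M W) (R : Type*) [CommRing R] (L : W → Γ) :
    Algebra (Coeff R Γ) (Hecke cs R L) :=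
  inferInstanceAs (Algebra (Coeff R Γ) (RingQuot (HeckeRel cs R L)))

/-- The element `T_w` of `H`. -/
def Hecke.T (cs : CoxeterSystem M W) (R : Type*) [CommRing R] (L : W → Γ) (w : W) : Hecke cs R L :=
  RingQuot.mkAlgHom (Coeff R Γ) (HeckeRel cs R L) (FreeAlgebra.ι _ w)

variable [LinearOrder Γ] [IsOrderedAddMonoid Γ]

/-- The `K`-algebra `H_K = K ⊗_A H`. -/
abbrev HeckeK (cs : CoxeterSystem M W) (R : Type*) [CommRing R] (L : W → Γ) : Type _ :=
  TensorProduct (Coeff R Γ) (GenField R Γ) (Hecke cs R L)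

/-- The element `T_w` of `H_K`. -/
def HeckeK.T (cs : CoxeterSystem M W) (R : Type*) [CommRing R] (L : W → Γ) (w : W) : HeckeK cs R L :=
  TensorProduct.tmul (Coeff R Γ) 1 (Hecke.T cs R L w)

end Hecke

/-! ### The valuation ring `𝒪` of `K` and constant terms -/

section Valuation

variable (R : Type*) [CommRing R] [IsDomain R] (Γ : Type*) [AddCommGroup Γ] [LinearOrder Γ]
  [IsOrderedAddMonoid Γ]

/-- The embedding `F → K` extending `R → A → K`. -/
def baseToGen : BaseField R →+* GenField R Γ :=
  IsFractionRing.lift (A := R) (K := BaseField R)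
    (g := (algebraMap (Coeff R Γ) (GenField R Γ)).comp (algebraMap R (Coeff R Γ)))
    ((IsFractionRing.injective (Coeff R Γ) (GenField R Γ)).comp
      (FaithfulSMul.algebraMap_injective R (Coeff R Γ)))

variable {Γ}

/-- The element `ε ^ g` of `K`. -/
def eps (g : Γ) : GenField R Γ :=
  algebraMap (Coeff R Γ) (GenField R Γ) (AddMonoidAlgebra.single g 1)

variable {R}

/-- The element `∑_g a_g ε ^ g` of `K` given by an element of `F[Γ]`. -/
def polyToGen (a : AddMonoidAlgebra (BaseField R) Γ) : GenField R Γ :=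
  a.coeff.sum fun g r => baseToGen R Γ r * eps R g

/-- Membership in `F[Γ_{>0}]`. -/
def IsPositivePart (p : AddMonoidAlgebra (BaseField R) Γ) : Prop :=
  ∀ g ∈ p.coeff.support, 0 < g

/-- `x = r ε ^ g (1 + p) / (1 + q)` with `p, q ∈ F[Γ_{>0}]`. For `x ≠ 0`, this determines `r = r_x`
and `g = g_x`; for `x = 0`, it says that `r = 0`, with `g` arbitrary. -/
def HasLeading (x : GenField R Γ) (r : BaseField R) (g : Γ) : Prop :=
  ∃ p q : AddMonoidAlgebra (BaseField R) Γ, IsPositivePart p ∧ IsPositivePart q ∧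
    x = baseToGen R Γ r * eps R g * ((1 + polyToGen p) / (1 + polyToGen q))

/-- Membership in the valuation ring `𝒪 = {x ∈ K | g_x ≥ 0}` (where `g_0 = +∞`). -/
def MemO (x : GenField R Γ) : Prop :=
  x = 0 ∨ ∃ (r : BaseField R) (g : Γ), 0 ≤ g ∧ HasLeading x r g

/-- Membership in the maximal ideal `𝔭 = {x ∈ K | g_x > 0}` (where `g_0 = +∞`). -/
def MemP (x : GenField R Γ) : Prop :=
  x = 0 ∨ ∃ (r : BaseField R) (g : Γ), 0 < g ∧ HasLeading x r g

open Classical in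
/-- The constant term of `x ∈ 𝒪`: the element `r` of `F` with `x ≡ r` modulo `𝔭`
(by convention `0` if `x ∉ 𝒪`). -/
def constTerm (x : GenField R Γ) : BaseField R :=
  if h : ∃ r : BaseField R, MemP (x - baseToGen R Γ r) then h.choose else 0

/-- `c = f ε ^ (-2a) +` a combination of terms `ε ^ g` where `g > -2a`, with `f ≠ 0`. -/
def HasLowestTerm (c : GenField R Γ) (a : Γ) (f : BaseField R) : Prop :=
  f ≠ 0 ∧ ∃ s : AddMonoidAlgebra (BaseField R) Γ, (∀ g ∈ s.coeff.support, -(2 • a) < g) ∧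
    c = baseToGen R Γ f * eps R (-(2 • a)) + polyToGen s

end Valuation

/-! ### Matrix representations of `H_K` -/

section Representations

variable {B W Γ : Type*} [Group W] [AddCommGroup Γ] [LinearOrder Γ] [IsOrderedAddMonoid Γ]
  {M : CoxeterMatrix B}

/-- Matrix representations `H_K → M_n(K)`. -/
abbrev MatRep (cs : CoxeterSystem M W) (R : Type*) [CommRing R] [IsDomain R] (L : W → Γ) (n : ℕ) :
    Type _ :=
  HeckeK cs R L →ₐ[GenField R Γ] Matrix (Fin n) (Fin n) (GenField R Γ)

variable {cs : CoxeterSystem M W} {R : Type*} [CommRing R] [IsDomain R] {L : W → Γ}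

/-- Irreducibility: `K^n` is nonzero, and its only invariant subspaces are `0` and `K^n`. -/
def IsIrred {n : ℕ} (ρ : MatRep cs R L n) : Prop :=
  0 < n ∧ ∀ V : Submodule (GenField R Γ) (Fin n → GenField R Γ),
    (∀ h : HeckeK cs R L, ∀ v ∈ V, (ρ h).mulVec v ∈ V) → V = ⊥ ∨ V = ⊤

/-- Equivalence over `K` of matrix representations. -/
def IsEquivalent {m n : ℕ} (ρ : MatRep cs R L m) (σ : MatRep cs R L n) : Prop :=
  ∃ U : (Fin m → GenField R Γ) ≃ₗ[GenField R Γ] (Fin n → GenField R Γ),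
    ∀ (h : HeckeK cs R L) (v : Fin m → GenField R Γ), U ((ρ h).mulVec v) = (σ h).mulVec (U v)

/-- `ρ` is a family of matrix representations afforded by the irreducible representations of
`H_K`, one for each isomorphism class. -/
structure IsCompleteFamily {Λ : Type*} {d : Λ → ℕ} (ρ : ∀ l, MatRep cs R L (d l)) : Prop where
  irred : ∀ l, IsIrred (ρ l)
  inequivalent : ∀ l m, IsEquivalent (ρ l) (ρ m) → l = m
  exhaustive : ∀ (n : ℕ) (σ : MatRep cs R L n), IsIrred σ → ∃ l, IsEquivalent σ (ρ l)

variable [Fintype W]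

/-- The Schur element `c`, given by `∑_w trace(T_w) trace(T_{w⁻¹}) = n c`. -/
def schurElt {n : ℕ} (ρ : MatRep cs R L n) : GenField R Γ :=
  (n : GenField R Γ)⁻¹ *
    ∑ w : W, (ρ (HeckeK.T cs R L w)).trace * (ρ (HeckeK.T cs R L w⁻¹)).trace

open Classical in
/-- The invariant `a ∈ Γ`, given by `c = f ε ^ (-2a) + higher terms`. -/
def aInv {n : ℕ} (ρ : MatRep cs R L n) : Γ :=
  if h : ∃ a : Γ, ∃ f : BaseField R, HasLowestTerm (schurElt ρ) a f then h.choose else 0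

open Classical in
/-- The coefficient `f ∈ F`, given by `c = f ε ^ (-2a) + higher terms`. -/
def fInv {n : ℕ} (ρ : MatRep cs R L n) : BaseField R :=
  if h : ∃ f : BaseField R, ∃ a : Γ, HasLowestTerm (schurElt ρ) a f then h.choose else 0

/-- `ρ` is balanced: `ε ^ a ρ_ij(T_w) ∈ 𝒪` for all `w, i, j`. -/
def IsBalanced {n : ℕ} (ρ : MatRep cs R L n) : Prop :=
  ∀ (w : W) (i j : Fin n), MemO (eps R (aInv ρ) * ρ (HeckeK.T cs R L w) i j)

/-- The leading matrix coefficient `c_w^{ij}`: the constant term of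
`(-1)^{l(w)} ε ^ a ρ_ij(T_w)`. -/
def leadCoeff {n : ℕ} (ρ : MatRep cs R L n) (w : W) (i j : Fin n) : BaseField R :=
  constTerm ((-1) ^ cs.length w * eps R (aInv ρ) * ρ (HeckeK.T cs R L w) i j)

/-- The structure constants `γ̃_{x,y,z}`. -/
def gammaTilde {Λ : Type*} [Fintype Λ] {d : Λ → ℕ} (ρ : ∀ l, MatRep cs R L (d l))
    (x y z : W) : BaseField R :=
  ∑ l, ∑ i, ∑ j, ∑ k, (fInv (ρ l))⁻¹ * leadCoeff (ρ l) x i j * leadCoeff (ρ l) y j k *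
    leadCoeff (ρ l) z k i

/-! ### The algebra `J̃` -/

/-- The `F`-vector space `J̃` with basis `t_w` (`w ∈ W`). -/
abbrev JTilde (W : Type*) (R : Type*) [CommRing R] : Type _ := W →₀ BaseField R

/-- The basis element `t_w` of `J̃`. -/
def tBasis (R : Type*) [CommRing R] (w : W) : JTilde W R := Finsupp.single w 1

/-- The bilinear product on `J̃` with `t_x t_y = ∑_z γ̃_{x,y,z⁻¹} t_z`. -/
def jMul {Λ : Type*} [Fintype Λ] {d : Λ → ℕ} (ρ : ∀ l, MatRep cs R L (d l)) :
    JTilde W R →ₗ[BaseField R] JTilde W R →ₗ[BaseField R] JTilde W R :=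
  Finsupp.linearCombination (BaseField R) fun x : W =>
    Finsupp.linearCombination (BaseField R) fun y : W =>
      ∑ z : W, gammaTilde ρ x y z⁻¹ • tBasis R z

/-- The linear map `J̃ → J̃` with `t_w ↦ t_{w⁻¹}`. -/
def jFlip (W : Type*) [Group W] (R : Type*) [CommRing R] [IsDomain R] :
    JTilde W R →ₗ[BaseField R] JTilde W R :=
  Finsupp.linearCombination (BaseField R) fun w : W => tBasis R w⁻¹

end Representations

end

end GeckHecke

/-!
The map `T_w ↦ T_{w⁻¹}` extends to an anti-automorphism `h ↦ h♭` of `H_K`, so every matrix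
representation `ρ` has a contragredient `h ↦ ρ(h♭)ᵀ`. Taking contragredients permutes the
irreducible representations and preserves Schur elements, hence the invariants `a_λ` and `f_λ`.
Since the constant term is a ring homomorphism `𝒪 → F` (it is the coefficient of `ε^0` once `K` is
embedded into the Hahn series `F⟦Γ⟧`), the sum `∑ c_x^{ij} c_y^{jk} c_z^{ki}` over `i, j, k` is the
constant term of `±ε^{3a} trace ρ(T_x T_y T_z)`. This depends only on the isomorphism class of `ρ`,
and passing to the contragredient replaces `(x, y, z)` by `(z⁻¹, y⁻¹, x⁻¹)`, a cyclic rotation of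
`(y⁻¹, x⁻¹, z⁻¹)`.
-/

namespace GeckHecke

noncomputable section

open MulOpposite

section HeckeFlip

variable {B W Γ : Type*} [Group W] [AddCommGroup Γ] {M : CoxeterMatrix B}
  (cs : CoxeterSystem M W) (R : Type*) [CommRing R] (L : W → Γ)

/-- The element `ε ^ L(s) - ε ^ (-L(s))` of `A`. -/
def quadCoeff (i : B) : Coeff R Γ :=
  AddMonoidAlgebra.single (L (cs.simple i)) 1 - AddMonoidAlgebra.single (-L (cs.simple i)) 1

namespace Hecke

theorem T_one : T cs R L 1 = 1 :=
  (RingQuot.mkAlgHom_rel (Coeff R Γ) (HeckeRel.one (cs := cs) (R := R) (L := L))).trans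
    (map_one _)

theorem T_simple_mul_of_lt {i : B} {w : W} (h : cs.length w < cs.length (cs.simple i * w)) :
    T cs R L (cs.simple i) * T cs R L w = T cs R L (cs.simple i * w) :=
  (map_mul _ _ _).symm.trans
    (RingQuot.mkAlgHom_rel (Coeff R Γ) (HeckeRel.up (R := R) (L := L) i w h))

theorem T_simple_mul_of_gt {i : B} {w : W} (h : cs.length (cs.simple i * w) < cs.length w) :
    T cs R L (cs.simple i) * T cs R L w =
      T cs R L (cs.simple i * w) + quadCoeff cs R L i • T cs R L w := by
  have hrel := RingQuot.mkAlgHom_rel (Coeff R Γ) (HeckeRel.down (R := R) (L := L) i w h)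
  rw [map_mul, map_add, map_smul] at hrel
  exact hrel

theorem T_mul_simple_of_lt {w : W} {i : B} (h : cs.length w < cs.length (w * cs.simple i)) :
    T cs R L w * T cs R L (cs.simple i) = T cs R L (w * cs.simple i) := by
  induction hn : cs.length w generalizing w with
  | zero =>
    obtain rfl := cs.length_eq_zero_iff.mp hn
    rw [T_one, one_mul, one_mul]
  | succ n ih =>
    have hw : w ≠ 1 := fun e => by simp [e] at hn
    obtain ⟨j, hj⟩ := cs.exists_leftDescent_of_ne_one hw
    obtain ⟨u, rfl⟩ : ∃ u, w = cs.simple j * u := ⟨cs.simple j * w, by simp⟩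
    have hu := cs.isLeftDescent_iff.mp hj
    rw [cs.simple_mul_simple_cancel_left] at hu
    rw [mul_assoc] at h
    have left_step := cs.length_simple_mul (u * cs.simple i) j
    have right_step := cs.length_mul_simple u i
    rw [← T_simple_mul_of_lt cs R L (by lia : cs.length u < cs.length (cs.simple j * u)),
      mul_assoc, ih (by lia) (by lia), mul_assoc,
      T_simple_mul_of_lt cs R L (by lia)]

theorem T_mul_simple_of_gt {w : W} {i : B} (h : cs.length (w * cs.simple i) < cs.length w) :
    T cs R L w * T cs R L (cs.simple i) =
      T cs R L (w * cs.simple i) + quadCoeff cs R L i • T cs R L w := by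
  obtain ⟨u, rfl⟩ : ∃ u, w = u * cs.simple i := ⟨w * cs.simple i, by simp⟩
  rw [cs.simple_mul_simple_cancel_right] at h ⊢
  have hs : T cs R L (cs.simple i) * T cs R L (cs.simple i) =
      1 + quadCoeff cs R L i • T cs R L (cs.simple i) := by
    rw [T_simple_mul_of_gt cs R L (by simp), cs.simple_mul_simple_self, T_one]
  rw [← T_mul_simple_of_lt cs R L h, mul_assoc, hs, mul_add, mul_one, mul_smul_comm]

/-- The anti-automorphism `T_w ↦ T_{w⁻¹}` of `H`. -/
def flip : Hecke cs R L →ₐ[Coeff R Γ] (Hecke cs R L)ᵐᵒᵖ :=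
  RingQuot.liftAlgHom (Coeff R Γ)
    ⟨FreeAlgebra.lift (Coeff R Γ) fun w => op (T cs R L w⁻¹), by
      rintro _ _ (_ | ⟨i, w, h⟩ | ⟨i, w, h⟩)
      · simp [T_one]
      · have h' : cs.length w⁻¹ < cs.length (w⁻¹ * cs.simple i) := by
          simpa [← cs.length_inv (cs.simple i * w)] using h
        simp [← op_mul, T_mul_simple_of_lt cs R L h']
      · have h' : cs.length (w⁻¹ * cs.simple i) < cs.length w⁻¹ := by
          simpa [← cs.length_inv (cs.simple i * w)] using h
        rw [map_mul, map_add, map_smul]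
        simp only [FreeAlgebra.lift_ι_apply]
        rw [← op_mul, cs.inv_simple, T_mul_simple_of_gt cs R L h', op_add, op_smul, mul_inv_rev,
          cs.inv_simple]
        rfl⟩

theorem flip_T (w : W) : flip cs R L (T cs R L w) = op (T cs R L w⁻¹) :=
  (RingQuot.liftAlgHom_mkAlgHom_apply _ _ _ _).trans (FreeAlgebra.lift_ι_apply _ _)

variable {cs R L}

theorem algHom_ext {C : Type*} [Ring C] [Algebra (Coeff R Γ) C]
    {f g : Hecke cs R L →ₐ[Coeff R Γ] C} (h : ∀ w, f (T cs R L w) = g (T cs R L w)) : f = g :=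
  RingQuot.ringQuot_ext' (Coeff R Γ) f g (FreeAlgebra.hom_ext (funext h))

end Hecke

end HeckeFlip

section Dual

variable {B W Γ : Type*} [Group W] [AddCommGroup Γ] {M : CoxeterMatrix B}

theorem HeckeK.algHom_ext {cs : CoxeterSystem M W} {R : Type*} [CommRing R] {L : W → Γ}
    {C : Type*} [Ring C] [Algebra (GenField R Γ) C]
    {f g : HeckeK cs R L →ₐ[GenField R Γ] C}
    (h : ∀ w, f (HeckeK.T cs R L w) = g (HeckeK.T cs R L w)) : f = g := by
  let _ : Algebra (Coeff R Γ) C :=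
    Algebra.compHom C (algebraMap (Coeff R Γ) (GenField R Γ))
  have : IsScalarTower (Coeff R Γ) (GenField R Γ) C := IsScalarTower.of_algebraMap_eq' rfl
  apply Algebra.TensorProduct.ext
  · ext
  · exact Hecke.algHom_ext h

variable (cs : CoxeterSystem M W) (R : Type*) [CommRing R] (L : W → Γ)

/-- The anti-automorphism `T_w ↦ T_{w⁻¹}` of `H_K`. -/
def HeckeK.flip : HeckeK cs R L →ₐ[GenField R Γ] (HeckeK cs R L)ᵐᵒᵖ :=
  Algebra.TensorProduct.lift (Algebra.ofId (GenField R Γ) (HeckeK cs R L)ᵐᵒᵖ)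
    ((AlgHom.op (Algebra.TensorProduct.includeRight :
      Hecke cs R L →ₐ[Coeff R Γ] HeckeK cs R L)).comp (Hecke.flip cs R L))
    fun _ _ => Algebra.commutes _ _

theorem HeckeK.flip_T (w : W) :
    HeckeK.flip cs R L (HeckeK.T cs R L w) = op (HeckeK.T cs R L w⁻¹) := by
  refine (Algebra.TensorProduct.lift_tmul _ _ _ _ _).trans ?_
  rw [map_one, one_mul, AlgHom.comp_apply, Hecke.flip_T]
  rfl

variable {cs R L} [IsDomain R]

namespace MatRep

/-- The contragredient `h ↦ ρ(h♭)ᵀ` of a matrix representation `ρ`, where `T_w♭ = T_{w⁻¹}`. -/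
def dual {n : ℕ} (ρ : MatRep cs R L n) : MatRep cs R L n :=
  (Matrix.transposeAlgEquiv (Fin n) (GenField R Γ) (GenField R Γ)).symm.toAlgHom.comp
    ((AlgHom.op ρ).comp (HeckeK.flip cs R L))

theorem dual_apply {n : ℕ} (ρ : MatRep cs R L n) (h : HeckeK cs R L) :
    ρ.dual h = (ρ (HeckeK.flip cs R L h).unop).transpose := rfl

theorem dual_T {n : ℕ} (ρ : MatRep cs R L n) (w : W) :
    ρ.dual (HeckeK.T cs R L w) = (ρ (HeckeK.T cs R L w⁻¹)).transpose := by
  rw [dual_apply, HeckeK.flip_T, unop_op]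

theorem dual_dual {n : ℕ} (ρ : MatRep cs R L n) : ρ.dual.dual = ρ :=
  HeckeK.algHom_ext fun w => by rw [dual_T, dual_T, inv_inv, Matrix.transpose_transpose]

theorem apply_eq_transpose_dual {n : ℕ} (ρ : MatRep cs R L n) (h : HeckeK cs R L) :
    ρ h = (ρ.dual (HeckeK.flip cs R L h).unop).transpose := by
  rw [← dual_apply, dual_dual]

end MatRep

open Matrix

theorem isEquivalent_iff {m n : ℕ} {ρ : MatRep cs R L m} {σ : MatRep cs R L n} :
    IsEquivalent ρ σ ↔ ∃ (P : Matrix (Fin n) (Fin m) (GenField R Γ))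
      (Q : Matrix (Fin m) (Fin n) (GenField R Γ)), P * Q = 1 ∧ Q * P = 1 ∧
        ∀ h, P * ρ h = σ h * P := by
  constructor
  · rintro ⟨U, hU⟩
    refine ⟨LinearMap.toMatrix' U.toLinearMap, LinearMap.toMatrix' U.symm.toLinearMap, ?_, ?_, ?_⟩
    · rw [← LinearMap.toMatrix'_comp, U.comp_symm, LinearMap.toMatrix'_id]
    · rw [← LinearMap.toMatrix'_comp, U.symm_comp, LinearMap.toMatrix'_id]
    · intro h
      apply Matrix.toLin'.injective
      refine LinearMap.ext fun v => ?_
      simpa [Matrix.toLin'_mul] using hU h v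
  · rintro ⟨P, Q, hPQ, hQP, hP⟩
    refine ⟨Matrix.toLin'OfInv hQP hPQ, fun x v => ?_⟩
    change P *ᵥ (ρ x *ᵥ v) = σ x *ᵥ (P *ᵥ v)
    rw [Matrix.mulVec_mulVec, Matrix.mulVec_mulVec, hP]

namespace IsEquivalent

variable {m n k : ℕ} {ρ : MatRep cs R L m} {σ : MatRep cs R L n} {τ : MatRep cs R L k}

theorem symm (h : IsEquivalent ρ σ) : IsEquivalent σ ρ := by
  obtain ⟨P, Q, hPQ, hQP, hP⟩ := isEquivalent_iff.mp h
  refine isEquivalent_iff.mpr ⟨Q, P, hQP, hPQ, fun x => ?_⟩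
  calc Q * σ x = Q * (σ x * P) * Q := by simp only [Matrix.mul_assoc, hPQ, Matrix.mul_one]
    _ = ρ x * Q := by rw [← hP, ← Matrix.mul_assoc, hQP, Matrix.one_mul]

theorem trans (h : IsEquivalent ρ σ) (h' : IsEquivalent σ τ) : IsEquivalent ρ τ := by
  obtain ⟨U, hU⟩ := h
  obtain ⟨V, hV⟩ := h'
  exact ⟨U.trans V, fun x v => by simp [hU, hV]⟩

theorem dual (h : IsEquivalent ρ σ) : IsEquivalent ρ.dual σ.dual := by
  obtain ⟨P, Q, hPQ, hQP, hP⟩ := isEquivalent_iff.mp h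
  refine symm (isEquivalent_iff.mpr ⟨Pᵀ, Qᵀ, ?_, ?_, fun x => ?_⟩)
  · rw [← Matrix.transpose_mul, hQP, Matrix.transpose_one]
  · rw [← Matrix.transpose_mul, hPQ, Matrix.transpose_one]
  · rw [MatRep.dual_apply, MatRep.dual_apply, ← Matrix.transpose_mul, ← Matrix.transpose_mul, hP]

theorem dim_eq (h : IsEquivalent ρ σ) : m = n := by
  obtain ⟨U, -⟩ := h
  simpa using U.finrank_eq

theorem trace_eq (h : IsEquivalent ρ σ) (x : HeckeK cs R L) : (ρ x).trace = (σ x).trace := by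
  obtain ⟨P, Q, hPQ, hQP, hP⟩ := isEquivalent_iff.mp h
  calc (ρ x).trace = (Q * (P * ρ x)).trace := by rw [← Matrix.mul_assoc, hQP, Matrix.one_mul]
    _ = (σ x).trace := by
      rw [hP, Matrix.trace_mul_comm, Matrix.mul_assoc, hPQ, Matrix.mul_one]

end IsEquivalent

variable [LinearOrder Γ] [IsOrderedAddMonoid Γ]

theorem IsIrred.dual {n : ℕ} {ρ : MatRep cs R L n} (hρ : IsIrred ρ) : IsIrred ρ.dual := by
  refine ⟨hρ.1, fun V hV => ?_⟩
  let e := dotProductEquiv (GenField R Γ) (Fin n)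
  let V' : Submodule (GenField R Γ) (Fin n → GenField R Γ) := V.dualAnnihilator.comap e.toLinearMap
  have mem_V' {u} : u ∈ V' ↔ ∀ v ∈ V, u ⬝ᵥ v = 0 := Submodule.mem_dualAnnihilator _
  have map_V' : V'.map e.toLinearMap = V.dualAnnihilator :=
    Submodule.map_comap_eq_of_surjective e.surjective _
  have hV' (h : HeckeK cs R L) (u) (hu : u ∈ V') : ρ h *ᵥ u ∈ V' := mem_V'.mpr fun v hv => by
    rw [MatRep.apply_eq_transpose_dual, dotProduct_comm, Matrix.dotProduct_mulVec,
      Matrix.vecMul_transpose, dotProduct_comm]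
    exact mem_V'.mp hu _ (hV _ v hv)
  rcases hρ.2 V' hV' with h | h <;> rw [h] at map_V'
  · rw [Submodule.map_bot] at map_V'
    exact Or.inr (Submodule.dualAnnihilator_eq_bot_iff.mp map_V'.symm)
  · rw [Submodule.map_top, LinearEquiv.range] at map_V'
    exact Or.inl (Submodule.dualAnnihilator_eq_top_iff.mp map_V'.symm)

variable {Λ : Type*} {d : Λ → ℕ} {ρ : ∀ l, MatRep cs R L (d l)}

theorem IsCompleteFamily.exists_dual_perm [Finite Λ] (hρ : IsCompleteFamily ρ) :
    ∃ e : Equiv.Perm Λ, ∀ l, IsEquivalent (ρ l).dual (ρ (e l)) := by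
  choose e he using fun l => hρ.exhaustive _ _ (hρ.irred l).dual
  have hinj : Function.Injective e := fun l l' hll => by
    have h := ((he l).trans (hll ▸ (he l').symm)).dual
    rw [MatRep.dual_dual, MatRep.dual_dual] at h
    exact hρ.inequivalent l l' h
  exact ⟨Equiv.ofBijective e (Finite.injective_iff_bijective.mp hinj), he⟩

end Dual

section HahnSeries

open HahnSeries

theorem orderTop_pos_iff {Γ k : Type*} [Zero Γ] [LinearOrder Γ] [Zero k] {x : k⟦Γ⟧} :
    0 < x.orderTop ↔ 0 ≤ x.orderTop ∧ x.coeff 0 = 0 :=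
  ⟨fun h => ⟨h.le, coeff_eq_zero_of_lt_orderTop h⟩,
    fun ⟨hle, h0⟩ => hle.lt_of_ne fun heq => coeff_orderTop_ne heq.symm h0⟩

variable {Γ k : Type*} [AddCommMonoid Γ] [LinearOrder Γ] [IsOrderedCancelAddMonoid Γ]

theorem coeff_zero_mul_of_orderTop_nonneg [Semiring k] {x y : k⟦Γ⟧} (hx : 0 ≤ x.orderTop)
    (hy : 0 ≤ y.orderTop) : (x * y).coeff 0 = x.coeff 0 * y.coeff 0 := by
  have nonneg {z : k⟦Γ⟧} (hz : 0 ≤ z.orderTop) {g : Γ} (hg : g ∈ z.support) : 0 ≤ g :=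
    WithTop.coe_le_coe.mp (hz.trans (orderTop_le_of_coeff_ne_zero hg))
  rw [coeff_mul]
  refine Finset.sum_eq_single (0, 0) (fun ⟨g, h⟩ hgh hne => ?_) fun h => ?_
  · obtain ⟨hg, hh, hsum⟩ := Finset.mem_antidiagonal.mp hgh
    obtain ⟨rfl, rfl⟩ := (add_eq_zero_iff_of_nonneg (nonneg hx hg) (nonneg hy hh)).mp hsum
    exact absurd rfl hne
  · by_contra hne
    exact h (Finset.mem_antidiagonal.mpr
      ⟨left_ne_zero_of_mul hne, right_ne_zero_of_mul hne, add_zero 0⟩)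

variable (Γ k) in
/-- The subring of Hahn series supported in `Γ_{≥0}`. -/
def integralSeries [Ring k] : Subring k⟦Γ⟧ where
  carrier := {x | 0 ≤ x.orderTop}
  zero_mem' := by simp
  one_mem' := zero_le_orderTop_iff.mpr order_one.ge
  add_mem' hx hy := Set.mem_ofPred.mpr <| (le_min hx hy).trans min_orderTop_le_orderTop_add
  mul_mem' hx hy := Set.mem_ofPred.mpr <| (add_nonneg hx hy).trans orderTop_add_le_mul
  neg_mem' hx := by simpa using hx

theorem mem_integralSeries [Ring k] {x : k⟦Γ⟧} : x ∈ integralSeries Γ k ↔ 0 ≤ x.orderTop :=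
  Set.mem_ofPred

variable (Γ k) in
/-- Reduction of a Hahn series supported in `Γ_{≥0}` modulo the series supported in `Γ_{>0}`. -/
def coeffZeroHom [Ring k] : integralSeries Γ k →+* k where
  toFun x := x.1.coeff 0
  map_zero' := rfl
  map_one' := coeff_single_same 0 1
  map_add' _ _ := rfl
  map_mul' x y := coeff_zero_mul_of_orderTop_nonneg
    (mem_integralSeries.mp x.2) (mem_integralSeries.mp y.2)

variable (Γ k) in
/-- The embedding of the monoid algebra `k[Γ]` into the Hahn series over `k`. -/
def polyToHahn [CommSemiring k] : AddMonoidAlgebra k Γ →ₐ[k] k⟦Γ⟧ :=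
  AddMonoidAlgebra.lift k k⟦Γ⟧ Γ
    { toFun := fun g => single g.toAdd 1
      map_one' := rfl
      map_mul' := fun _ _ => by rw [single_mul_single, one_mul, toAdd_mul] }

theorem polyToHahn_single [CommSemiring k] (g : Γ) (r : k) :
    polyToHahn Γ k (AddMonoidAlgebra.single g r) = single g r := by
  rw [polyToHahn, AddMonoidAlgebra.lift_single, ← single_zero_mul_eq_smul]
  exact single_mul_single.trans (by rw [zero_add, mul_one, toAdd_ofAdd])

theorem coeff_polyToHahn [CommSemiring k] (a : AddMonoidAlgebra k Γ) (g : Γ) :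
    (polyToHahn Γ k a).coeff g = a.coeff g := by
  induction a using AddMonoidAlgebra.induction_linear with
  | zero => simp
  | add a b ha hb => simp [ha, hb]
  | single h r =>
    rw [polyToHahn_single, AddMonoidAlgebra.coeff_single]
    obtain rfl | hne := eq_or_ne g h
    · rw [coeff_single_same, Finsupp.single_eq_same]
    · rw [coeff_single_of_ne hne, Finsupp.single_eq_of_ne hne]

theorem polyToHahn_injective [CommSemiring k] : Function.Injective (polyToHahn Γ k) :=
  fun a b h => AddMonoidAlgebra.ext <| Finsupp.ext fun g => by
    rw [← coeff_polyToHahn, h, coeff_polyToHahn]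

theorem orderTop_one_add_polyToHahn [CommSemiring k] [Nontrivial k] {p : AddMonoidAlgebra k Γ}
    (hp : ∀ g ∈ p.coeff.support, 0 < g) : (1 + polyToHahn Γ k p).orderTop = 0 := by
  have hpos : 0 < (polyToHahn Γ k p).orderTop := by
    by_contra! h
    obtain ⟨g, hg⟩ := WithTop.ne_top_iff_exists.mp (h.trans_lt (WithTop.coe_lt_top 0)).ne
    have hg0 : 0 < g := hp g <| Finsupp.mem_support_iff.mpr <| by
      rw [← coeff_polyToHahn]
      exact coeff_orderTop_ne hg.symm
    exact hg0.not_ge (WithTop.coe_le_coe.mp (hg.trans_le h))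
  rw [orderTop_add_eq_left (by rwa [orderTop_one]), orderTop_one]

theorem exists_eq_single_mul_one_add {Γ k : Type*} [AddCommGroup Γ] [LinearOrder Γ]
    [IsOrderedAddMonoid Γ] [Field k] (a : AddMonoidAlgebra k Γ) :
    ∃ (r : k) (g : Γ) (p : AddMonoidAlgebra k Γ), (∀ h ∈ p.coeff.support, 0 < h) ∧
      a = AddMonoidAlgebra.single g r * (1 + p) := by
  obtain rfl | ha := eq_or_ne a 0
  · exact ⟨0, 0, 0, by simp, by simp⟩
  have hsupp : a.coeff.support.Nonempty := by
    rwa [Finsupp.support_nonempty_iff, ne_eq, AddMonoidAlgebra.coeff_eq_zero]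
  let g := a.coeff.support.min' hsupp
  have hr : a.coeff g ≠ 0 := Finsupp.mem_support_iff.mp (a.coeff.support.min'_mem hsupp)
  refine ⟨a.coeff g, g, AddMonoidAlgebra.single (-g) (a.coeff g)⁻¹ * a - 1, fun h hh => ?_, ?_⟩
  · obtain rfl | h0 := eq_or_ne h 0
    · simp [AddMonoidAlgebra.one_def, hr] at hh
    · have hgh : a.coeff (g + h) ≠ 0 := by
        simpa [AddMonoidAlgebra.one_def, h0, h0.symm, hr] using hh
      have hle : g ≤ g + h := a.coeff.support.min'_le _ (Finsupp.mem_support_iff.mpr hgh)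
      exact (nonneg_of_le_add_right hle).lt_of_ne' h0
  · rw [add_sub_cancel, ← mul_assoc, AddMonoidAlgebra.single_mul_single, add_neg_cancel,
      mul_inv_cancel₀ hr, ← AddMonoidAlgebra.one_def, one_mul]

end HahnSeries

section Valuation

open HahnSeries

variable {R Γ : Type*} [CommRing R] [AddCommGroup Γ] [LinearOrder Γ] [IsOrderedAddMonoid Γ]

variable (R Γ) in
/-- The embedding of `A = R[Γ]` into `F⟦Γ⟧`. -/
def coeffToHahn : Coeff R Γ →+* (BaseField R)⟦Γ⟧ :=
  (polyToHahn Γ (BaseField R)).toRingHom.comp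
    (AddMonoidAlgebra.mapRingHom Γ (algebraMap R (BaseField R)))

theorem coeffToHahn_injective : Function.Injective (coeffToHahn R Γ) :=
  polyToHahn_injective.comp fun a b h => AddMonoidAlgebra.ext <| Finsupp.ext fun g =>
    IsFractionRing.injective R (BaseField R) <| by
      rw [← AddMonoidAlgebra.coeff_mapRingHom, h, AddMonoidAlgebra.coeff_mapRingHom]

variable [IsDomain R]

variable (R Γ) in
/-- The embedding of `K` into the field of Hahn series over `F`, whose valuation `orderTop`
restricts to `x ↦ g_x` on `K`. -/
def genToHahn : GenField R Γ →+* (BaseField R)⟦Γ⟧ :=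
  IsFractionRing.lift (A := Coeff R Γ) coeffToHahn_injective

theorem genToHahn_algebraMap (a : Coeff R Γ) :
    genToHahn R Γ (algebraMap (Coeff R Γ) (GenField R Γ) a) =
      polyToHahn Γ (BaseField R) (AddMonoidAlgebra.mapRingHom Γ (algebraMap R (BaseField R)) a) :=
  IsFractionRing.lift_algebraMap _ a

theorem genToHahn_eps (g : Γ) : genToHahn R Γ (eps R g) = single g 1 := by
  rw [eps, genToHahn_algebraMap, AddMonoidAlgebra.mapRingHom_single, map_one, polyToHahn_single]

theorem genToHahn_baseToGen (r : BaseField R) : genToHahn R Γ (baseToGen R Γ r) = C r := by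
  suffices h : (genToHahn R Γ).comp (baseToGen R Γ) = C from RingHom.congr_fun h r
  refine IsLocalization.ringHom_ext (nonZeroDivisors R) (RingHom.ext fun s => ?_)
  change genToHahn R Γ (baseToGen R Γ (algebraMap R (BaseField R) s)) = C (algebraMap R _ s)
  rw [baseToGen, IsFractionRing.lift_algebraMap]
  change genToHahn R Γ (algebraMap (Coeff R Γ) _ (AddMonoidAlgebra.single 0 s)) = _
  rw [genToHahn_algebraMap, AddMonoidAlgebra.mapRingHom_single, polyToHahn_single, C_apply]

theorem genToHahn_polyToGen (a : AddMonoidAlgebra (BaseField R) Γ) :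
    genToHahn R Γ (polyToGen a) = polyToHahn Γ (BaseField R) a := by
  rw [polyToGen, map_finsuppSum, polyToHahn, AddMonoidAlgebra.lift_apply]
  refine Finsupp.sum_congr fun g _ => ?_
  rw [map_mul, genToHahn_baseToGen, genToHahn_eps, C_mul_eq_smul]
  rfl

theorem HasLeading.orderTop_genToHahn {x : GenField R Γ} {r : BaseField R} {g : Γ}
    (h : HasLeading x r g) : (genToHahn R Γ x).orderTop = (single g r).orderTop := by
  obtain ⟨p, q, hp, hq, rfl⟩ := h
  have hquot : ((1 + polyToHahn Γ _ p) / (1 + polyToHahn Γ _ q)).orderTop = 0 := by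
    have hne : 1 + polyToHahn Γ _ q ≠ 0 := fun h0 => by
      simpa [h0] using orderTop_one_add_polyToHahn hq
    simpa [orderTop_one_add_polyToHahn hp, orderTop_one_add_polyToHahn hq] using
      congrArg orderTop (div_mul_cancel₀ (1 + polyToHahn Γ _ p) hne)
  simp only [map_mul, map_div₀, map_add, map_one, genToHahn_baseToGen, genToHahn_eps,
    genToHahn_polyToGen, orderTop_mul, hquot, add_zero]
  rw [← orderTop_mul, C_apply, single_mul_single, zero_add, mul_one]

theorem exists_algebraMap_eq (a : Coeff R Γ) :
    ∃ (r : BaseField R) (g : Γ) (p : AddMonoidAlgebra (BaseField R) Γ), IsPositivePart p ∧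
      algebraMap (Coeff R Γ) (GenField R Γ) a =
        baseToGen R Γ r * eps R g * (1 + polyToGen p) := by
  obtain ⟨r, g, p, hp, ha⟩ := exists_eq_single_mul_one_add
    (AddMonoidAlgebra.mapRingHom Γ (algebraMap R (BaseField R)) a)
  refine ⟨r, g, p, hp, (genToHahn R Γ).injective ?_⟩
  rw [genToHahn_algebraMap, ha]
  simp only [map_mul, map_add, map_one, polyToHahn_single, genToHahn_baseToGen, genToHahn_eps,
    genToHahn_polyToGen, C_apply, single_mul_single, zero_add, mul_one]

theorem exists_hasLeading (x : GenField R Γ) :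
    ∃ (r : BaseField R) (g : Γ), HasLeading x r g := by
  obtain ⟨a, b, -, rfl⟩ := IsFractionRing.div_surjective (A := Coeff R Γ) x
  obtain ⟨r, g, p, hp, ha⟩ := exists_algebraMap_eq a
  obtain ⟨s, h, q, hq, hb⟩ := exists_algebraMap_eq b
  have heps : eps R (g - h) = eps R g / eps R h := (genToHahn R Γ).injective <| by
    rw [map_div₀, genToHahn_eps, genToHahn_eps, genToHahn_eps, single_div_single, div_one]
  refine ⟨r / s, g - h, p, q, hp, hq, ?_⟩
  rw [ha, hb, map_div₀, heps, mul_div_mul_comm, mul_div_mul_comm]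

theorem memP_iff {x : GenField R Γ} : MemP x ↔ 0 < (genToHahn R Γ x).orderTop := by
  constructor
  · rintro (rfl | ⟨r, g, hg, h⟩)
    · simp
    · rw [h.orderTop_genToHahn]
      exact (WithTop.coe_lt_coe.mpr hg).trans_le orderTop_single_le
  · intro hx
    obtain ⟨r, g, h⟩ := exists_hasLeading x
    rw [h.orderTop_genToHahn] at hx
    obtain rfl | hr := eq_or_ne r 0
    · obtain ⟨p, q, -, -, rfl⟩ := h
      exact Or.inl (by simp)
    · rw [orderTop_single hr] at hx
      exact Or.inr ⟨r, g, WithTop.coe_lt_coe.mp hx, h⟩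

variable (R Γ) in
/-- The valuation ring `𝒪` as a subring of `K`. -/
def valRing : Subring (GenField R Γ) :=
  (integralSeries Γ (BaseField R)).comap (genToHahn R Γ)

theorem mem_valRing {x : GenField R Γ} : x ∈ valRing R Γ ↔ 0 ≤ (genToHahn R Γ x).orderTop :=
  Subring.mem_comap.trans mem_integralSeries

theorem MemO.mem_valRing {x : GenField R Γ} (hx : MemO x) : x ∈ valRing R Γ := by
  obtain rfl | ⟨r, g, hg, h⟩ := hx
  · exact zero_mem _
  · rw [GeckHecke.mem_valRing, h.orderTop_genToHahn]
    exact (WithTop.coe_le_coe.mpr hg).trans orderTop_single_le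

variable (R Γ) in
/-- The map sending `x ∈ 𝒪` to its constant term, as a ring homomorphism `𝒪 → F`. -/
def constTermHom : valRing R Γ →+* BaseField R :=
  (coeffZeroHom Γ (BaseField R)).comp ((genToHahn R Γ).restrict _ _ fun _ hx => hx)

theorem memP_sub_baseToGen_iff {x : valRing R Γ} {r : BaseField R} :
    MemP (x - baseToGen R Γ r : GenField R Γ) ↔ r = constTermHom R Γ x := by
  have hC : (C r : (BaseField R)⟦Γ⟧) ∈ integralSeries Γ (BaseField R) :=
    mem_integralSeries.mpr orderTop_single_le
  have hcoeff : (genToHahn R Γ x - C r).coeff 0 = constTermHom R Γ x - r :=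
    congrArg (constTermHom R Γ x - ·) (coeff_single_same 0 r)
  rw [memP_iff, orderTop_pos_iff, map_sub, genToHahn_baseToGen, hcoeff, sub_eq_zero,
    and_iff_right (mem_integralSeries.mp (sub_mem x.2 hC)), eq_comm]

theorem constTerm_eq (x : valRing R Γ) : constTerm (x : GenField R Γ) = constTermHom R Γ x := by
  have hex : ∃ r : BaseField R, MemP (x - baseToGen R Γ r : GenField R Γ) :=
    ⟨_, memP_sub_baseToGen_iff.mpr rfl⟩
  rw [constTerm, dif_pos hex]
  exact memP_sub_baseToGen_iff.mp hex.choose_spec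

end Valuation

section LeadingMatrices

open Matrix

variable {B W Γ : Type*} [Group W] [Fintype W] [AddCommGroup Γ] [LinearOrder Γ]
  [IsOrderedAddMonoid Γ] {M : CoxeterMatrix B} {cs : CoxeterSystem M W} {R : Type*} [CommRing R]
  [IsDomain R] {L : W → Γ} {m n : ℕ} {ρ : MatRep cs R L m} {σ : MatRep cs R L n}

theorem aInv_congr (h : schurElt ρ = schurElt σ) : aInv ρ = aInv σ := by
  rw [aInv, aInv, h]

theorem fInv_congr (h : schurElt ρ = schurElt σ) : fInv ρ = fInv σ := by
  rw [fInv, fInv, h]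

theorem IsEquivalent.schurElt_eq (h : IsEquivalent ρ σ) : schurElt ρ = schurElt σ := by
  simp only [schurElt, h.trace_eq, h.dim_eq]

theorem MatRep.schurElt_dual (ρ : MatRep cs R L n) : schurElt ρ.dual = schurElt ρ := by
  simp only [schurElt, dual_T, trace_transpose, inv_inv, mul_comm]

/-- The matrix `(-1)^{l(w)} ε^a ρ(T_w)`, whose constant terms are the leading coefficients. -/
def scaledMatrix (ρ : MatRep cs R L n) (w : W) : Matrix (Fin n) (Fin n) (GenField R Γ) :=
  ((-1) ^ cs.length w * eps R (aInv ρ)) • ρ (HeckeK.T cs R L w)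

theorem MatRep.scaledMatrix_dual (ρ : MatRep cs R L n) (w : W) :
    scaledMatrix ρ.dual w = (scaledMatrix ρ w⁻¹)ᵀ := by
  rw [scaledMatrix, scaledMatrix, dual_T, aInv_congr ρ.schurElt_dual, cs.length_inv,
    transpose_smul]

theorem IsEquivalent.trace_scaledMatrix_mul (h : IsEquivalent ρ σ) (x y z : W) :
    (scaledMatrix ρ x * scaledMatrix ρ y * scaledMatrix ρ z).trace =
      (scaledMatrix σ x * scaledMatrix σ y * scaledMatrix σ z).trace := by
  simp only [scaledMatrix, aInv_congr h.schurElt_eq, ← map_smul, ← map_mul, h.trace_eq]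

theorem IsBalanced.scaledMatrix_mem_valRing (hρ : IsBalanced ρ) (w : W) (i j : Fin m) :
    scaledMatrix ρ w i j ∈ valRing R Γ := by
  rw [scaledMatrix, Matrix.smul_apply, smul_eq_mul, mul_assoc]
  exact mul_mem (pow_mem (neg_mem (one_mem _)) _) (hρ w i j).mem_valRing

/-- The matrix `(c_w^{ij})` of leading coefficients. -/
def leadMatrix (ρ : MatRep cs R L n) (w : W) : Matrix (Fin n) (Fin n) (BaseField R) :=
  Matrix.of (leadCoeff ρ w)

theorem IsBalanced.trace_leadMatrix_mul (hρ : IsBalanced ρ) (x y z : W) :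
    (leadMatrix ρ x * leadMatrix ρ y * leadMatrix ρ z).trace =
      constTerm (scaledMatrix ρ x * scaledMatrix ρ y * scaledMatrix ρ z).trace := by
  let N (w : W) : Matrix (Fin m) (Fin m) (valRing R Γ) :=
    Matrix.of fun i j => ⟨scaledMatrix ρ w i j, hρ.scaledMatrix_mem_valRing w i j⟩
  have scaled_eq (w : W) : scaledMatrix ρ w = (valRing R Γ).subtype.mapMatrix (N w) := rfl
  have lead_eq (w : W) : leadMatrix ρ w = (constTermHom R Γ).mapMatrix (N w) :=
    Matrix.ext fun i j => constTerm_eq (N w i j)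
  simp only [scaled_eq, lead_eq, ← map_mul]
  simp only [RingHom.mapMatrix_apply, ← AddMonoidHom.map_trace]
  exact (constTerm_eq _).symm

theorem IsEquivalent.trace_leadMatrix_mul_inv (h : IsEquivalent ρ.dual σ) (hρ : IsBalanced ρ)
    (hσ : IsBalanced σ) (x y z : W) :
    (leadMatrix ρ x * leadMatrix ρ y * leadMatrix ρ z).trace =
      (leadMatrix σ y⁻¹ * leadMatrix σ x⁻¹ * leadMatrix σ z⁻¹).trace := by
  rw [hρ.trace_leadMatrix_mul, hσ.trace_leadMatrix_mul, ← h.trace_scaledMatrix_mul]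
  simp only [MatRep.scaledMatrix_dual, inv_inv]
  rw [← transpose_mul, ← transpose_mul, trace_transpose, trace_mul_comm]

end LeadingMatrices

section JTilde

variable {B W Γ Λ : Type*} [Group W] [AddCommGroup Γ] [LinearOrder Γ] [IsOrderedAddMonoid Γ]
  {M : CoxeterMatrix B} {cs : CoxeterSystem M W} {R : Type*} [CommRing R] [IsDomain R]
  {L : W → Γ} {d : Λ → ℕ} {ρ : ∀ l, MatRep cs R L (d l)}

theorem jFlip_tBasis (w : W) : jFlip W R (tBasis R w) = tBasis R w⁻¹ := by
  rw [jFlip, tBasis, Finsupp.linearCombination_single, one_smul]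

theorem jFlip_jFlip (a : JTilde W R) : jFlip W R (jFlip W R a) = a := by
  suffices h : (jFlip W R).comp (jFlip W R) = LinearMap.id from LinearMap.congr_fun h a
  refine Finsupp.lhom_ext' fun w => LinearMap.ext_ring ?_
  change jFlip W R (jFlip W R (tBasis R w)) = tBasis R w
  rw [jFlip_tBasis, jFlip_tBasis, inv_inv]

variable [Fintype W] [Fintype Λ]

theorem gammaTilde_eq_sum_trace (ρ : ∀ l, MatRep cs R L (d l)) (x y z : W) :
    gammaTilde ρ x y z = ∑ l, (fInv (ρ l))⁻¹ *
      (leadMatrix (ρ l) x * leadMatrix (ρ l) y * leadMatrix (ρ l) z).trace := by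
  simp only [gammaTilde, leadMatrix, Matrix.trace, Matrix.diag_apply, Matrix.mul_apply,
    Matrix.of_apply, Finset.mul_sum, mul_assoc]

theorem gammaTilde_inv (hρ : IsCompleteFamily ρ) (hbal : ∀ l, IsBalanced (ρ l)) (x y z : W) :
    gammaTilde ρ x y z = gammaTilde ρ y⁻¹ x⁻¹ z⁻¹ := by
  obtain ⟨e, he⟩ := hρ.exists_dual_perm
  rw [gammaTilde_eq_sum_trace, gammaTilde_eq_sum_trace]
  refine Fintype.sum_equiv e _ _ fun l => ?_
  have hschur : schurElt (ρ l) = schurElt (ρ (e l)) :=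
    (ρ l).schurElt_dual.symm.trans (he l).schurElt_eq
  rw [fInv_congr hschur, (he l).trace_leadMatrix_mul_inv (hbal l) (hbal (e l))]

theorem jMul_tBasis (x y : W) :
    jMul ρ (tBasis R x) (tBasis R y) = ∑ z : W, gammaTilde ρ x y z⁻¹ • tBasis R z := by
  simp only [jMul, tBasis, Finsupp.linearCombination_single, one_smul]

theorem jFlip_jMul (h : ∀ x y z, gammaTilde ρ x y z = gammaTilde ρ y⁻¹ x⁻¹ z⁻¹)
    (a b : JTilde W R) :
    jFlip W R (jMul ρ a b) = jMul ρ (jFlip W R b) (jFlip W R a) := by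
  suffices key : (jMul ρ).compr₂ (jFlip W R) =
      (jMul ρ).flip.compl₁₂ (jFlip W R) (jFlip W R) from LinearMap.congr_fun₂ key a b
  refine Finsupp.lhom_ext' fun x => LinearMap.ext_ring <|
    Finsupp.lhom_ext' fun y => LinearMap.ext_ring ?_
  change jFlip W R (jMul ρ (tBasis R x) (tBasis R y)) =
    jMul ρ (jFlip W R (tBasis R y)) (jFlip W R (tBasis R x))
  calc jFlip W R (jMul ρ (tBasis R x) (tBasis R y))
      = ∑ z : W, gammaTilde ρ y⁻¹ x⁻¹ z • tBasis R z⁻¹ := by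
        simp only [jMul_tBasis, map_sum, map_smul, jFlip_tBasis, h x y, inv_inv]
    _ = ∑ z : W, gammaTilde ρ y⁻¹ x⁻¹ z⁻¹ • tBasis R z :=
        Fintype.sum_equiv (Equiv.inv W) _ _ fun z => by rw [Equiv.inv_apply, inv_inv]
    _ = jMul ρ (jFlip W R (tBasis R y)) (jFlip W R (tBasis R x)) := by
        rw [jFlip_tBasis, jFlip_tBasis, jMul_tBasis]

end JTilde

end

end GeckHecke

theorem proposition3p8_general
    {B W Γ Λ : Type*} [Group W] [Fintype W] {M : CoxeterMatrix B} {cs : CoxeterSystem M W}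
    [AddCommGroup Γ] [LinearOrder Γ] [IsOrderedAddMonoid Γ] {L : W → Γ}
    {R : Type*} [CommRing R] [IsDomain R] [CharZero R]
    [Fintype Λ] {d : Λ → ℕ} {ρ : ∀ l : Λ, GeckHecke.MatRep cs R L (d l)}
    (hρ : GeckHecke.IsCompleteFamily ρ) (hbal : ∀ l : Λ, GeckHecke.IsBalanced (ρ l)) :
    (∀ a : GeckHecke.JTilde W R, GeckHecke.jFlip W R (GeckHecke.jFlip W R a) = a) ∧
    (∀ a b : GeckHecke.JTilde W R,
      GeckHecke.jFlip W R (GeckHecke.jMul ρ a b) =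
        GeckHecke.jMul ρ (GeckHecke.jFlip W R b) (GeckHecke.jFlip W R a)) ∧
    (∀ x y z : W, GeckHecke.gammaTilde ρ x y z = GeckHecke.gammaTilde ρ y⁻¹ x⁻¹ z⁻¹) :=
  have hγ := GeckHecke.gammaTilde_inv hρ hbal
  ⟨GeckHecke.jFlip_jFlip, GeckHecke.jFlip_jMul hγ, hγ⟩

theorem proposition3p8
    {B W Γ Λ : Type*} [Group W] [Fintype W] {M : CoxeterMatrix B} (cs : CoxeterSystem M W)
    [AddCommGroup Γ] [LinearOrder Γ] [IsOrderedAddMonoid Γ]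
    (L : W → Γ) (hL : GeckHecke.IsWeightFunction cs L) (hLpos : ∀ i : B, 0 < L (cs.simple i))
    (R : Subring ℂ) (hR : GeckHecke.cosRing cs ≤ R)
    [Fintype Λ] (d : Λ → ℕ) (ρ : ∀ l : Λ, GeckHecke.MatRep cs R L (d l))
    (hρ : GeckHecke.IsCompleteFamily ρ) (hbal : ∀ l : Λ, GeckHecke.IsBalanced (ρ l)) :
    (∀ a : GeckHecke.JTilde W R, GeckHecke.jFlip W R (GeckHecke.jFlip W R a) = a) ∧
    (∀ a b : GeckHecke.JTilde W R,
      GeckHecke.jFlip W R (GeckHecke.jMul ρ a b) =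
        GeckHecke.jMul ρ (GeckHecke.jFlip W R b) (GeckHecke.jFlip W R a)) ∧
    (∀ x y z : W, GeckHecke.gammaTilde ρ x y z = GeckHecke.gammaTilde ρ y⁻¹ x⁻¹ z⁻¹) :=
  proposition3p8_general hρ hbal
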